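/- Fix an integer $\mathfrak m\ge 2$. For a finite graph $A$ (finite, simple, undirected) let $\delta(A)=\mathfrak m\,|A|-|R(A)|$, where $R(A)$ is the set of edges of $A$. For a graph $N$ and a finite set $A$ of vertices of $N$ (with the induced graph structure) write $A\leqslant N$ if $\delta(A)\le\delta(B)$ for every finite $B$ with $A\subseteq B\subseteq N$. Let $\mathsf K_0$ be the class of finite graphs $A$ with $\delta(A')\ge 0$ for all $A'\subseteq A$. Let $\mathbf M$ be the $(\mathsf K_0,\leqslant)$-generic structure, that is, the countable graph (unique up to isomorphism) such that: $\mathbf M$ is the union of a chain of finite sets $C_i\leqslant\mathbf M$; every isomorphism between finite sets $A,B\leqslant\mathbf M$ extends to an automorphism of $\mathbf M$; every member of $\mathsf K_0$ is isomorphic to some finite $A\leqslant\mathbf M$. For finite $A\subseteq\mathbf M$ let $\mathrm{cl}(A)$ be the smallest finite set with $A\subseteq \mathrm{cl}(A)\leqslant\mathbf M$, and let $\mathrm d(A)=\delta(\mathrm{cl}(A))$. For $X\subseteq\mathbf M$ let $\mathrm{gcl}(X)$ be the set of all $v\in\mathbf M$ such that $\mathrm d(A\cup\{v\})-\mathrm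 d(A)=0$ for some finite $A\subseteq X$. Let $\mathbf G=\mathrm{Aut}(\mathbf M)$ and, for $X\subseteq\mathbf M$, let $\mathbf G_{\{X\}}=\{g\in\mathbf G: g[X]=X\}$. Automorphism groups of countable graphs carry the topology of pointwise convergence (the set of vertices being discrete), and $\mathbf G_{\{X\}}$ carries the subspace topology. A subgroup $H$ of a group $\Gamma$ has small index if $[\Gamma:H]<2^{\aleph_0}$; a topological group has the small index property (SIP) if each of its subgroups of small index is open. Let $X=\mathrm{gcl}(A)$ where $A\subseteq\mathbf M$ is finite, and regard $X$ as an induced subgraph of $\mathbf M$. Then: 1. $\mathbf G_{\{X\}}$ is a clopen subgroup of $\mathbf G$, and it is a Polish group. 2. $\mathbf G_{\{X\}}$ has small index in $\mathbf G$. 3. If $\mathbf G_{\{X\}}$ has SIP, then $\mathbf G$ has SIP. 4. The restriction map $\pi_X:\mathbf G_{\{X\}}\to\mathrm{Aut}(X)$, $h\mapsto h\restriction X$, is a group homomorphism which is continuous, surjective and open. -/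

import Mathlib

namespace AbInitio

open Classical in
/-- The pre-dimension `δ(A) = 𝔪 · |A| - |R(A)|` of a finite set `A` of vertices of a graph `G`,
where `R(A)` is the set of edges of `G` with both ends in `A`. -/
noncomputable def delta {V : Type*} (m : ℕ) (G : SimpleGraph V) (A : Finset V) : ℤ :=
  (m : ℤ) * A.card - ((A.sym2.filter fun e => e ∈ G.edgeSet).card : ℤ)

/-- `H` belongs to the class `K₀`: every finite substructure has nonnegative pre-dimension. -/
def InK0 {W : Type*} (m : ℕ) (H : SimpleGraph W) : Prop :=
  Finite W ∧ ∀ A : Finset W, 0 ≤ delta m H A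

/-- The finite set `A` is self-sufficient in `G`, written `A ⩽ G`: every finite superset of `A`
in `G` has pre-dimension at least that of `A`. -/
def SelfSuff {V : Type*} (m : ℕ) (G : SimpleGraph V) (A : Finset V) : Prop :=
  ∀ B : Finset V, A ⊆ B → delta m G A ≤ delta m G B

/-- `G` is the `(K₀, ⩽)`-generic structure (which is unique up to isomorphism). -/
structure IsGeneric {V : Type*} (m : ℕ) (G : SimpleGraph V) : Prop where
  countable : Countable V
  /-- `G` is the union of a chain of finite self-sufficient sets. -/
  chain : ∃ C : ℕ → Finset V, Monotone C ∧ (∀ i, SelfSuff m G (C i)) ∧ ∀ v, ∃ i, v ∈ C i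
  /-- Isomorphisms between finite self-sufficient sets extend to automorphisms. -/
  homogeneous : ∀ A B : Finset V, SelfSuff m G A → SelfSuff m G B →
    ∀ f : G.induce (A : Set V) ≃g G.induce (B : Set V),
      ∃ g : G ≃g G, ∀ a : (A : Set V), g a = f a
  /-- Every member of `K₀` is isomorphic to a self-sufficient subset of `G`. -/
  universal : ∀ (n : ℕ) (H : SimpleGraph (Fin n)), InK0 m H →
    ∃ f : H ↪g G, SelfSuff m G (Finset.univ.map f.toEmbedding)

open Classical in
/-- The closure `cl(A)`: the smallest finite self-sufficient set containing `A`. It exists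
in a generic structure by `isLeast_cl` below; the default value is never used there. -/
noncomputable def cl {V : Type*} (m : ℕ) (G : SimpleGraph V) (A : Finset V) : Finset V :=
  if h : ∃ C, IsLeast {C : Finset V | A ⊆ C ∧ SelfSuff m G C} C then h.choose else A

/-- The dimension `d(A) = δ(cl(A))` of a finite set. -/
noncomputable def dim {V : Type*} (m : ℕ) (G : SimpleGraph V) (A : Finset V) : ℤ :=
  delta m G (cl m G A)

open Classical in
/-- The geometric closure `gcl(X) = {v : d(v / A) = 0 for some finite A ⊆ X}`, where
`d(v / A) = d(A ∪ {v}) - d(A)`. -/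
def gcl {V : Type*} (m : ℕ) (G : SimpleGraph V) (X : Set V) : Set V :=
  {v | ∃ A : Finset V, (A : Set V) ⊆ X ∧ dim m G (insert v A) - dim m G A = 0}

theorem delta_union_add_inter_le {V : Type*} [DecidableEq V] (m : ℕ) (G : SimpleGraph V)
    (A B : Finset V) :
    delta m G (A ∪ B) + delta m G (A ∩ B) ≤ delta m G A + delta m G B := by
  classical
  unfold delta
  have h1 : ((A ∪ B).card : ℤ) + (A ∩ B).card = A.card + B.card := by
    exact_mod_cast Finset.card_union_add_card_inter A B
  have h2 := Finset.card_union_add_card_inter (A.sym2.filter fun e => e ∈ G.edgeSet)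
    (B.sym2.filter fun e => e ∈ G.edgeSet)
  have h3 : (A.sym2.filter fun e => e ∈ G.edgeSet) ∩ (B.sym2.filter fun e => e ∈ G.edgeSet)
      = (A ∩ B).sym2.filter fun e => e ∈ G.edgeSet := by
    ext e
    simp only [Finset.mem_inter, Finset.mem_filter, Finset.mem_sym2_iff]
    grind
  have h4 : (A.sym2.filter fun e => e ∈ G.edgeSet) ∪ (B.sym2.filter fun e => e ∈ G.edgeSet)
      ⊆ (A ∪ B).sym2.filter fun e => e ∈ G.edgeSet := by
    intro e
    simp only [Finset.mem_union, Finset.mem_filter, Finset.mem_sym2_iff]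
    grind
  have h5 := Finset.card_le_card h4
  rw [h3] at h2
  have h6 : (m : ℤ) * (A ∪ B).card + m * (A ∩ B).card = m * A.card + m * B.card := by
    rw [← mul_add, ← mul_add, h1]
  zify at h2 h5
  linarith

theorem SelfSuff.inter {V : Type*} [DecidableEq V] {m : ℕ} {G : SimpleGraph V} {C D : Finset V}
    (hC : SelfSuff m G C) (hD : SelfSuff m G D) : SelfSuff m G (C ∩ D) := by
  have key : ∀ (E B : Finset V), SelfSuff m G E → delta m G (B ∩ E) ≤ delta m G B := by
    intro E B hE
    have h1 := delta_union_add_inter_le m G B E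
    have h2 := hE (B ∪ E) Finset.subset_union_right
    linarith
  intro B hB
  have h1 := key C B hC
  have h2 := key D (B ∩ C) hD
  have h3 : B ∩ C ∩ D = C ∩ D := by
    rw [Finset.inter_assoc]
    exact Finset.inter_eq_right.2 hB
  rw [h3] at h2
  exact h2.trans h1

theorem isLeast_cl {V : Type*} {m : ℕ} {G : SimpleGraph V} (hG : IsGeneric m G)
    (A : Finset V) : IsLeast {C : Finset V | A ⊆ C ∧ SelfSuff m G C} (cl m G A) := by
  classical
  obtain ⟨C, hmono, hC, hcov⟩ := hG.chain
  have hex : ∃ C : Finset V, A ⊆ C ∧ SelfSuff m G C := by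
    have : ∃ i, A ⊆ C i := by
      induction A using Finset.induction_on with
      | empty => exact ⟨0, Finset.empty_subset _⟩
      | insert a s _ ih =>
        obtain ⟨i, hi⟩ := ih
        obtain ⟨j, hj⟩ := hcov a
        exact ⟨max i j, Finset.insert_subset (hmono (le_max_right i j) hj)
          (hi.trans (hmono (le_max_left i j)))⟩
    obtain ⟨i, hi⟩ := this
    exact ⟨C i, hi, hC i⟩
  have hleast : ∃ C, IsLeast {C : Finset V | A ⊆ C ∧ SelfSuff m G C} C := by
    obtain ⟨E, hE, hEn⟩ := Nat.sInf_mem (Set.Nonempty.image Finset.card hex)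
    refine ⟨E, hE, fun D hD => ?_⟩
    have h1 : E ∩ D ∈ {C : Finset V | A ⊆ C ∧ SelfSuff m G C} :=
      ⟨Finset.subset_inter hE.1 hD.1, hE.2.inter hD.2⟩
    have h2 : E.card ≤ (E ∩ D).card := by
      rw [hEn]
      exact Nat.sInf_le ⟨_, h1, rfl⟩
    have h3 : E ∩ D = E := Finset.eq_of_subset_of_card_le Finset.inter_subset_left h2
    exact Finset.inter_eq_left.1 h3
  unfold cl
  rw [dif_pos hleast]
  exact hleast.choose_spec

/-- The topology of pointwise convergence on the automorphism group of a graph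
(whose set of vertices is discrete). -/
instance autTopology {V : Type*} (G : SimpleGraph V) : TopologicalSpace (G ≃g G) :=
  TopologicalSpace.induced (fun (g : G ≃g G) (v : V) => g v)
    (@Pi.topologicalSpace V (fun _ => V) fun _ => ⊥)

/-- The setwise stabiliser of `X` in the automorphism group of `G`. -/
def setStab {V : Type*} (G : SimpleGraph V) (X : Set V) : Subgroup (G ≃g G) where
  carrier := {g | g '' X = X}
  one_mem' := by simp
  mul_mem' := by
    intro a b ha hb
    change (a * b) '' X = X
    rw [RelIso.coe_mul, Set.image_comp, show b '' X = X from hb, show a '' X = X from ha]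
  inv_mem' := by
    intro a ha
    change (⇑(a⁻¹) : V → V) '' X = X
    conv_lhs => rw [← show a '' X = X from ha]
    rw [← Set.image_comp, ← RelIso.coe_mul, inv_mul_cancel]
    simp

theorem setStab_apply_mem {V : Type*} {G : SimpleGraph V} {X : Set V} {g : G ≃g G}
    (hg : g ∈ setStab G X) {x : V} (hx : x ∈ X) : g x ∈ X :=
  (show g '' X = X from hg) ▸ Set.mem_image_of_mem g hx

/-- The restriction map `π_X : G_{X} → Aut(X)`, `h ↦ h ↾ X`. -/
def restrictHom {V : Type*} (G : SimpleGraph V) (X : Set V) :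
    setStab G X →* (G.induce X ≃g G.induce X) where
  toFun h :=
    { toFun := fun x => ⟨h.1 x, setStab_apply_mem h.2 x.2⟩
      invFun := fun x => ⟨h.1⁻¹ x, setStab_apply_mem (inv_mem h.2) x.2⟩
      left_inv := fun x => Subtype.ext (RelIso.inv_apply_self h.1 x.1)
      right_inv := fun x => Subtype.ext (RelIso.apply_inv_self h.1 x.1)
      map_rel_iff' := h.1.map_rel_iff' }
  map_one' := rfl
  map_mul' _ _ := rfl

@[simp] theorem restrictHom_apply_coe {V : Type*} (G : SimpleGraph V) (X : Set V)
    (h : setStab G X) (x : X) : ((restrictHom G X h x : X) : V) = h.1 x := rfl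

/-- `H` has small index in `Γ`: `[Γ : H] < 2 ^ ℵ₀`. -/
def SmallIndex {Γ : Type*} [Group Γ] (H : Subgroup Γ) : Prop :=
  Cardinal.mk (Γ ⧸ H) < Cardinal.continuum

/-- The small index property: every subgroup of small index is open. -/
def HasSIP (Γ : Type*) [Group Γ] [TopologicalSpace Γ] : Prop :=
  ∀ H : Subgroup Γ, SmallIndex H → IsOpen (H : Set Γ)

end AbInitio

/-! Put K = cl(A). By submodularity of the predimension, X = gcl(A) is the union of all finite F ⊇ K
with δ(F) = δ(K) (`gcl_eq_zeroHull`). So X is determined by K, and the stabiliser of X contains the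
pointwise stabiliser of the finite set K: it is open, hence closed, and has countable index. SIP
then passes up from an open subgroup.

Surjectivity and openness of restriction come from one back-and-forth. To lift an automorphism φ of
X, use pairs (g, E), where E is finite and self-sufficient, E ∩ X is a base (self-sufficient, with δ
= δ(K)), and the automorphism g of the whole graph agrees with φ on E ∩ X. If E grows to E', the
larger base F' = E' ∩ X is freely amalgamated with E, and likewise φ[F'] with g[E]. So g on E and φ
on F' glue to an isomorphism of self-sufficient sets, which homogeneity extends
(`IsApprox.exists_extension`). Starting from K gives surjectivity; starting from a given h on a
closed set E gives openness. -/

namespace AbInitio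

/-! ### Strict submodularity, invariance and homogeneity -/

section Predimension

variable {V : Type*} {m : ℕ} {G : SimpleGraph V}

/-- The crossing edge is counted in the union but in neither part. Hence equality in submodularity
forces free amalgamation. -/
theorem delta_union_add_inter_lt [DecidableEq V] {A B : Finset V} {u w : V}
    (hu : u ∈ A) (huB : u ∉ B) (hw : w ∈ B) (hwA : w ∉ A) (huw : G.Adj u w) :
    delta m G (A ∪ B) + delta m G (A ∩ B) < delta m G A + delta m G B := by
  classical
  unfold delta
  have h1 : ((A ∪ B).card : ℤ) + (A ∩ B).card = A.card + B.card := by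
    exact_mod_cast Finset.card_union_add_card_inter A B
  have h2 := Finset.card_union_add_card_inter (A.sym2.filter fun e => e ∈ G.edgeSet)
    (B.sym2.filter fun e => e ∈ G.edgeSet)
  have h3 : (A.sym2.filter fun e => e ∈ G.edgeSet) ∩ (B.sym2.filter fun e => e ∈ G.edgeSet)
      = (A ∩ B).sym2.filter fun e => e ∈ G.edgeSet := by
    ext e
    simp only [Finset.mem_inter, Finset.mem_filter, Finset.mem_sym2_iff]
    grind
  have h4 : (A.sym2.filter fun e => e ∈ G.edgeSet) ∪ (B.sym2.filter fun e => e ∈ G.edgeSet)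
      ⊂ (A ∪ B).sym2.filter fun e => e ∈ G.edgeSet := by
    refine Finset.ssubset_iff_subset_ne.2 ⟨?_, fun h => ?_⟩
    · intro e
      simp only [Finset.mem_union, Finset.mem_filter, Finset.mem_sym2_iff]
      grind
    · have : s(u, w) ∈ (A ∪ B).sym2.filter fun e => e ∈ G.edgeSet := by
        simp [hu, hw, huw]
      rw [← h] at this
      simp [huB, hwA] at this
  have h5 := Finset.card_lt_card h4
  rw [h3] at h2
  have h6 : (m : ℤ) * (A ∪ B).card + m * (A ∩ B).card = m * A.card + m * B.card := by
    rw [← mul_add, ← mul_add, h1]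
  zify at h2 h5
  linarith

theorem delta_image [DecidableEq V] {p : V → V} {F : Finset V} (hp : Set.InjOn p F)
    (hadj : ∀ u ∈ F, ∀ w ∈ F, (G.Adj (p u) (p w) ↔ G.Adj u w)) :
    delta m G (F.image p) = delta m G F := by
  classical
  unfold delta
  rw [Finset.card_image_of_injOn hp]
  congr 2
  symm
  refine Finset.card_bij (fun e _ => Sym2.map p e) ?_ ?_ ?_
  · intro e
    induction e with | _ u w
    simp only [Finset.mem_filter, Finset.mk_mem_sym2_iff, SimpleGraph.mem_edgeSet, Sym2.map_mk]
    rintro ⟨⟨hu, hw⟩, h⟩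
    exact ⟨⟨Finset.mem_image_of_mem p hu, Finset.mem_image_of_mem p hw⟩,
      (hadj u hu w hw).2 h⟩
  · intro e he e' he' h
    induction e with | _ u w
    induction e' with | _ u' w'
    simp only [Finset.mem_filter, Finset.mk_mem_sym2_iff] at he he'
    simp only [Sym2.map_mk, Sym2.eq_iff] at h ⊢
    rcases h with ⟨h1, h2⟩ | ⟨h1, h2⟩
    · exact Or.inl ⟨hp he.1.1 he'.1.1 h1, hp he.1.2 he'.1.2 h2⟩
    · exact Or.inr ⟨hp he.1.1 he'.1.2 h1, hp he.1.2 he'.1.1 h2⟩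
  · intro e
    induction e with | _ a b
    simp only [Finset.mem_filter, Finset.mk_mem_sym2_iff, SimpleGraph.mem_edgeSet,
      Finset.mem_image]
    rintro ⟨⟨⟨u, hu, rfl⟩, ⟨w, hw, rfl⟩⟩, h⟩
    exact ⟨s(u, w), by simpa using ⟨⟨hu, hw⟩, (hadj u hu w hw).1 h⟩, rfl⟩

theorem delta_image_aut [DecidableEq V] (g : G ≃g G) (F : Finset V) :
    delta m G (F.image g) = delta m G F :=
  delta_image g.injective.injOn fun _ _ _ _ => g.map_adj_iff

theorem SelfSuff.image_aut [DecidableEq V] {F : Finset V} (hF : SelfSuff m G F) (g : G ≃g G) :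
    SelfSuff m G (F.image g) := by
  intro B hB
  rw [delta_image_aut, ← delta_image_aut g.symm B]
  refine hF _ fun v hv => ?_
  exact Finset.mem_image.2 ⟨g v, hB (Finset.mem_image_of_mem g hv), g.symm_apply_apply v⟩

theorem SelfSuff.of_subset_of_delta_le {E F : Finset V} (hE : SelfSuff m G E) (hEF : E ⊆ F)
    (hd : delta m G F ≤ delta m G E) : SelfSuff m G F :=
  fun B hB => hd.trans (hE B (hEF.trans hB))

theorem SelfSuff.delta_inter_le [DecidableEq V] {E : Finset V} (hE : SelfSuff m G E)
    (B : Finset V) : delta m G (B ∩ E) ≤ delta m G B := by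
  have h1 := delta_union_add_inter_le m G B E
  have h2 := hE (B ∪ E) Finset.subset_union_right
  linarith

/-- Homogeneity, for partial isomorphisms given as restrictions of a function. -/
theorem IsGeneric.exists_extension [DecidableEq V] (hG : IsGeneric m G) {p : V → V}
    {F : Finset V} (hF : SelfSuff m G F) (hpF : SelfSuff m G (F.image p)) (hp : Set.InjOn p F)
    (hadj : ∀ u ∈ F, ∀ w ∈ F, (G.Adj (p u) (p w) ↔ G.Adj u w)) :
    ∃ g : G ≃g G, ∀ v ∈ F, g v = p v := by
  have hbij : Set.BijOn p (F : Set V) (F.image p : Finset V) := by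
    rw [Finset.coe_image]
    exact hp.bijOn_image
  obtain ⟨g, hg⟩ := hG.homogeneous F (F.image p) hF hpF
    { toEquiv := hbij.equiv p
      map_rel_iff' := fun {a b} => hadj a a.2 b b.2 }
  exact ⟨g, fun v hv => hg ⟨v, hv⟩⟩

theorem subset_cl (hG : IsGeneric m G) (A : Finset V) : A ⊆ cl m G A := (isLeast_cl hG A).1.1

theorem selfSuff_cl (hG : IsGeneric m G) (A : Finset V) : SelfSuff m G (cl m G A) :=
  (isLeast_cl hG A).1.2

theorem cl_subset (hG : IsGeneric m G) {A C : Finset V} (hAC : A ⊆ C) (hC : SelfSuff m G C) :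
    cl m G A ⊆ C := (isLeast_cl hG A).2 ⟨hAC, hC⟩

end Predimension

/-! ### Geometric closure as a union of zero extensions; bases -/

section GeometricClosure

variable {V : Type*} {m : ℕ} {G : SimpleGraph V}

/-- The union of all finite extensions of `K` of relative predimension zero. -/
def zeroHull (m : ℕ) (G : SimpleGraph V) (K : Finset V) : Set V :=
  {v | ∃ F : Finset V, K ⊆ F ∧ delta m G F = delta m G K ∧ v ∈ F}

/-- If d(v/A') = 0 with A' ⊆ A, submodularity for cl(A'v) and cl(A), whose intersection contains A',
makes their union a zero extension of cl(A). Conversely, a zero extension F of cl(A) is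
self-sufficient, so cl(Av) ⊆ F and d(Av) ≤ δ(F). -/
theorem gcl_eq_zeroHull (hG : IsGeneric m G) (A : Finset V) :
    gcl m G (A : Set V) = zeroHull m G (cl m G A) := by
  classical
  ext v
  constructor
  · rintro ⟨A', hA', hd⟩
    have hA' : A' ⊆ A := by exact_mod_cast hA'
    have hd : dim m G (insert v A') = dim m G A' := by
      have : dim m G (insert v A') - dim m G A' = 0 := by convert hd
      linarith
    unfold dim at hd
    have h1 := delta_union_add_inter_le m G (cl m G (insert v A')) (cl m G A)
    have h2 : delta m G (cl m G A') ≤ delta m G (cl m G (insert v A') ∩ cl m G A) := by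
      refine selfSuff_cl hG A' _ (Finset.subset_inter ?_ ?_)
      · exact cl_subset hG ((Finset.subset_insert _ _).trans (subset_cl hG _)) (selfSuff_cl hG _)
      · exact cl_subset hG (hA'.trans (subset_cl hG _)) (selfSuff_cl hG _)
    refine ⟨cl m G (insert v A') ∪ cl m G A, Finset.subset_union_right, le_antisymm ?_ ?_, ?_⟩
    · linarith
    · exact selfSuff_cl hG A _ Finset.subset_union_right
    · exact Finset.mem_union_left _ (subset_cl hG _ (Finset.mem_insert_self _ _))
  · rintro ⟨F, hKF, hF, hv⟩
    refine ⟨A, subset_rfl, sub_eq_zero.2 ?_⟩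
    have h : dim m G (insert v A) = dim m G A := by
      unfold dim
      refine le_antisymm ?_ ?_
      · rw [← hF]
        refine selfSuff_cl hG _ _ (cl_subset hG ?_ ?_)
        · exact Finset.insert_subset hv ((subset_cl hG A).trans hKF)
        · exact (selfSuff_cl hG A).of_subset_of_delta_le hKF hF.le
      · exact selfSuff_cl hG A _ (cl_subset hG
          ((Finset.subset_insert _ _).trans (subset_cl hG _)) (selfSuff_cl hG _))
    convert h

theorem subset_zeroHull (K : Finset V) : (K : Set V) ⊆ zeroHull m G K :=
  fun _ hv => ⟨K, subset_rfl, rfl, hv⟩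

/-- Zero extensions of K are closed under unions: their intersection contains K, so its predimension
is at least δ(K), and submodularity bounds the union. -/
theorem exists_superset_of_subset_zeroHull [DecidableEq V] {K : Finset V} (hK : SelfSuff m G K)
    {B : Finset V} (hB : (B : Set V) ⊆ zeroHull m G K) :
    ∃ F : Finset V, K ⊆ F ∧ B ⊆ F ∧ (F : Set V) ⊆ zeroHull m G K ∧
      delta m G F = delta m G K ∧ SelfSuff m G F := by
  suffices h : ∃ F : Finset V, K ⊆ F ∧ B ⊆ F ∧ delta m G F = delta m G K by
    obtain ⟨F, h1, h2, h3⟩ := h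
    exact ⟨F, h1, h2, fun v hv => ⟨F, h1, h3, hv⟩, h3, hK.of_subset_of_delta_le h1 h3.le⟩
  induction B using Finset.induction_on with
  | empty => exact ⟨K, subset_rfl, Finset.empty_subset _, rfl⟩
  | insert a s _ ih =>
    rw [Finset.coe_insert, Set.insert_subset_iff] at hB
    obtain ⟨F, h1, h2, h3⟩ := ih hB.2
    obtain ⟨F', h1', h3', ha⟩ := hB.1
    refine ⟨F' ∪ F, h1.trans Finset.subset_union_right, Finset.insert_subset
      (Finset.mem_union_left _ ha) (h2.trans Finset.subset_union_right), le_antisymm ?_ ?_⟩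
    · have h4 := delta_union_add_inter_le m G F' F
      have h5 := hK _ (Finset.subset_inter h1' h1)
      linarith
    · exact hK _ (h1.trans Finset.subset_union_right)

/-- The finite self-sufficient subsets of `zeroHull m G K` of full dimension. -/
structure IsBase (m : ℕ) (G : SimpleGraph V) (K F : Finset V) : Prop where
  subset : (F : Set V) ⊆ zeroHull m G K
  selfSuff : SelfSuff m G F
  delta_eq : delta m G F = delta m G K

theorem isBase_self {K : Finset V} (hK : SelfSuff m G K) : IsBase m G K K :=
  ⟨subset_zeroHull K, hK, rfl⟩

theorem IsBase.of_superset [DecidableEq V] {K F F' : Finset V} (hK : SelfSuff m G K)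
    (hF : IsBase m G K F) (hFF' : F ⊆ F') (hsub : (F' : Set V) ⊆ zeroHull m G K)
    (hF' : SelfSuff m G F') : IsBase m G K F' := by
  refine ⟨hsub, hF', le_antisymm ?_ ?_⟩
  · obtain ⟨D, _, hD, _, h, _⟩ := exists_superset_of_subset_zeroHull hK hsub
    exact h ▸ hF' D hD
  · exact hF.delta_eq ▸ hF.selfSuff F' hFF'

/-- A base need not contain K, yet it generates the same hull. -/
theorem IsBase.mem_zeroHull_iff [DecidableEq V] {K F : Finset V} (hK : SelfSuff m G K)
    (hF : IsBase m G K F) {v : V} : v ∈ zeroHull m G K ↔ v ∈ zeroHull m G F := by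
  constructor
  · intro hv
    obtain ⟨D, _, h2, _, h4, _⟩ := exists_superset_of_subset_zeroHull (m := m) (G := G)
      (B := insert v F) hK (by simpa [Set.insert_subset_iff] using ⟨hv, hF.subset⟩)
    exact ⟨D, (Finset.subset_insert _ _).trans h2, h4.trans hF.delta_eq.symm,
      h2 (Finset.mem_insert_self _ _)⟩
  · rintro ⟨D, h1, h2, hv⟩
    obtain ⟨D', h1', h2', _, h4', _⟩ := exists_superset_of_subset_zeroHull hK hF.subset
    refine ⟨D ∪ D', h1'.trans Finset.subset_union_right, le_antisymm ?_ ?_,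
      Finset.mem_union_left _ hv⟩
    · have h5 := delta_union_add_inter_le m G D D'
      have h6 := hF.selfSuff _ (Finset.subset_inter h1 h2')
      have := hF.delta_eq
      linarith
    · exact hK _ (h1'.trans Finset.subset_union_right)

theorem mem_zeroHull_image_aut [DecidableEq V] (g : G ≃g G) {K : Finset V} {v : V}
    (hv : v ∈ zeroHull m G K) : g v ∈ zeroHull m G (K.image g) := by
  obtain ⟨F, h1, h2, h3⟩ := hv
  exact ⟨F.image g, Finset.image_subset_image h1, by simp only [delta_image_aut, h2],
    Finset.mem_image_of_mem g h3⟩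

theorem mem_zeroHull_image_aut_iff [DecidableEq V] (g : G ≃g G) {K : Finset V} {v : V} :
    g v ∈ zeroHull m G (K.image g) ↔ v ∈ zeroHull m G K := by
  refine ⟨fun h => ?_, mem_zeroHull_image_aut g⟩
  have := mem_zeroHull_image_aut g.symm h
  rwa [Finset.image_image, show (g.symm : V → V) ∘ g = id from funext g.symm_apply_apply,
    Finset.image_id, g.symm_apply_apply] at this

open Classical in
-- The trace of E on the hull lies in a finite self-sufficient F inside the hull, so it equals E ∩
-- F.
theorem SelfSuff.filter_zeroHull {K E : Finset V} (hK : SelfSuff m G K) (hE : SelfSuff m G E) :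
    SelfSuff m G (E.filter (· ∈ zeroHull m G K)) := by
  obtain ⟨F, _, h2, h3, _, h5⟩ := exists_superset_of_subset_zeroHull (m := m) (G := G)
    (B := E.filter (· ∈ zeroHull m G K)) hK (fun v hv => by simp at hv; exact hv.2)
  have : E.filter (· ∈ zeroHull m G K) = E ∩ F := by
    ext v
    refine ⟨fun hv => Finset.mem_inter.2 ⟨(Finset.mem_filter.1 hv).1, h2 hv⟩, fun hv => ?_⟩
    rw [Finset.mem_inter] at hv
    exact Finset.mem_filter.2 ⟨hv.1, h3 hv.2⟩
  rw [this]
  exact hE.inter h5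

open Classical in
theorem delta_filter_zeroHull_le {K : Finset V} (hK : SelfSuff m G K) (B : Finset V) :
    delta m G (B.filter (· ∈ zeroHull m G K)) ≤ delta m G B := by
  obtain ⟨F, _, h2, h3, _, h5⟩ := exists_superset_of_subset_zeroHull (m := m) (G := G)
    (B := B.filter (· ∈ zeroHull m G K)) hK (fun v hv => by simp at hv; exact hv.2)
  have : B.filter (· ∈ zeroHull m G K) = B ∩ F := by
    ext v
    refine ⟨fun hv => Finset.mem_inter.2 ⟨(Finset.mem_filter.1 hv).1, h2 hv⟩, fun hv => ?_⟩
    rw [Finset.mem_inter] at hv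
    exact Finset.mem_filter.2 ⟨hv.1, h3 hv.2⟩
  rw [this]
  exact h5.delta_inter_le B

/-- A self-sufficient set and a base are freely amalgamated. -/
theorem IsBase.delta_union_eq [DecidableEq V] {K E F F' : Finset V}
    (hF : IsBase m G K F) (hE : SelfSuff m G E) (hF' : IsBase m G K F') (hFE : F ⊆ E)
    (hFF' : F ⊆ F') :
    delta m G (E ∪ F') = delta m G E ∧ SelfSuff m G (E ∪ F') ∧
      ∀ u ∈ E, u ∉ F' → ∀ w ∈ F', w ∉ E → ¬ G.Adj u w := by
  -- Since F ⊆ E ∩ F', the intersection has predimension at least δ(F) = δ(F'); submodularity then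
  -- gives δ(E ∪ F') ≤ δ(E).
  have h1 := hF.selfSuff _ (Finset.subset_inter hFE hFF')
  have h2 := hF.delta_eq
  have h3 := hF'.delta_eq
  have h4 := hE _ (Finset.subset_union_left (s₂ := F'))
  have h5 := delta_union_add_inter_le m G E F'
  have h6 : delta m G (E ∪ F') = delta m G E := by linarith
  refine ⟨h6, hE.of_subset_of_delta_le Finset.subset_union_left h6.le, ?_⟩
  intro u hu huF w hw hwE huw
  have := delta_union_add_inter_lt (m := m) hu huF hw hwE huw
  linarith

end GeometricClosure

/-! ### Lifting automorphisms of the hull by back-and-forth -/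

section Extension

variable {V : Type*} {m : ℕ} {G : SimpleGraph V}

/-- The permutation `φ` of the vertices restricts to an automorphism of the graph induced
on `S`. -/
structure RestrictsToAut (G : SimpleGraph V) (S : Set V) (φ : V ≃ V) : Prop where
  mem_iff : ∀ v, φ v ∈ S ↔ v ∈ S
  adj_iff : ∀ u ∈ S, ∀ w ∈ S, (G.Adj (φ u) (φ w) ↔ G.Adj u w)

theorem RestrictsToAut.symm {S : Set V} {φ : V ≃ V} (h : RestrictsToAut G S φ) :
    RestrictsToAut G S φ.symm := by
  have hmem : ∀ v, φ.symm v ∈ S ↔ v ∈ S := fun v => by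
    rw [← h.mem_iff, φ.apply_symm_apply]
  refine ⟨hmem, fun u hu w hw => ?_⟩
  rw [← h.adj_iff _ ((hmem u).2 hu) _ ((hmem w).2 hw), φ.apply_symm_apply, φ.apply_symm_apply]

theorem RestrictsToAut.delta_image [DecidableEq V] {S : Set V} {φ : V ≃ V}
    (h : RestrictsToAut G S φ) {F : Finset V} (hF : (F : Set V) ⊆ S) :
    delta m G (F.image φ) = delta m G F :=
  AbInitio.delta_image φ.injective.injOn fun u hu w hw => h.adj_iff u (hF hu) w (hF hw)

/-- Cutting a finite set down to the hull does not raise δ, so self-sufficiency of a subset of the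
hull can be tested inside the hull, where φ preserves δ. -/
theorem RestrictsToAut.isBase_image [DecidableEq V] {K : Finset V} {φ : V ≃ V}
    (hK : SelfSuff m G K) (h : RestrictsToAut G (zeroHull m G K) φ) {F : Finset V}
    (hF : IsBase m G K F) : IsBase m G K (F.image φ) := by
  classical
  refine ⟨?_, fun B hB => ?_, (h.delta_image hF.subset).trans hF.delta_eq⟩
  · intro v hv
    obtain ⟨u, hu, rfl⟩ := Finset.mem_image.1 hv
    exact (h.mem_iff u).2 (hF.subset hu)
  · rw [h.delta_image hF.subset]
    refine le_trans ?_ (delta_filter_zeroHull_le hK B)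
    rw [← h.symm.delta_image (F := B.filter (· ∈ zeroHull m G K))
      (fun v hv => (Finset.mem_filter.1 hv).2)]
    refine hF.selfSuff _ fun v hv => Finset.mem_image.2 ⟨φ v, ?_, φ.symm_apply_apply v⟩
    exact Finset.mem_filter.2 ⟨hB (Finset.mem_image_of_mem φ hv),
      (h.mem_iff v).2 (hF.subset hv)⟩

open Classical in
/-- The automorphism `g` agrees with `φ` on the part of the self-sufficient set `E` lying in
`zeroHull m G K`, and that part is a base. -/
structure IsApprox (m : ℕ) (G : SimpleGraph V) (K : Finset V) (φ : V ≃ V) (g : G ≃g G)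
    (E : Finset V) : Prop where
  selfSuff : SelfSuff m G E
  isBase : IsBase m G K (E.filter (· ∈ zeroHull m G K))
  eq_of_mem : ∀ v ∈ E, v ∈ zeroHull m G K → g v = φ v

section

variable {K : Finset V} {φ : V ≃ V} {g : G ≃g G} {E : Finset V}

open Classical in
theorem IsApprox.image_filter (hg : IsApprox m G K φ g E) :
    (E.filter (· ∈ zeroHull m G K)).image g = (E.filter (· ∈ zeroHull m G K)).image φ :=
  Finset.image_congr fun v hv => by
    rw [Finset.mem_coe, Finset.mem_filter] at hv
    exact hg.eq_of_mem v hv.1 hv.2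

/-- Agreement on a base F suffices: g[F] = φ[F] is again a base, and both F and g[F] generate the
hull. -/
theorem IsApprox.mem_zeroHull_iff (hK : SelfSuff m G K)
    (hφ : RestrictsToAut G (zeroHull m G K) φ) (hg : IsApprox m G K φ g E) (v : V) :
    g v ∈ zeroHull m G K ↔ v ∈ zeroHull m G K := by
  classical
  have h := hφ.isBase_image hK hg.isBase
  rw [← hg.image_filter] at h
  rw [h.mem_zeroHull_iff hK, mem_zeroHull_image_aut_iff, ← hg.isBase.mem_zeroHull_iff hK]

open Classical in
theorem IsApprox.symm (hK : SelfSuff m G K)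
    (hφ : RestrictsToAut G (zeroHull m G K) φ) (hg : IsApprox m G K φ g E) :
    IsApprox m G K φ.symm g.symm (E.image g) := by
  have hmem := hg.mem_zeroHull_iff hK hφ
  refine ⟨hg.selfSuff.image_aut g, ?_, ?_⟩
  · convert hφ.isBase_image hK hg.isBase using 1
    rw [← hg.image_filter]
    ext v
    simp only [Finset.mem_filter, Finset.mem_image]
    constructor
    · rintro ⟨⟨u, hu, rfl⟩, h⟩
      exact ⟨u, ⟨hu, (hmem u).1 h⟩, rfl⟩
    · rintro ⟨u, ⟨hu, h⟩, rfl⟩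
      exact ⟨⟨u, hu, rfl⟩, (hmem u).2 h⟩
  · intro v hv hvX
    obtain ⟨u, hu, rfl⟩ := Finset.mem_image.1 hv
    rw [g.symm_apply_apply, hg.eq_of_mem u hu ((hmem u).1 hvX), φ.symm_apply_apply]

/-- Amalgamation step: E ∪ F' and g[E] ∪ φ[F'] are both self-sufficient with no crossing edges, so
gluing g and φ gives an isomorphism to which homogeneity applies. -/
theorem IsApprox.exists_extension (hG : IsGeneric m G) (hK : SelfSuff m G K)
    (hφ : RestrictsToAut G (zeroHull m G K) φ) (hg : IsApprox m G K φ g E) {E' : Finset V}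
    (hE' : SelfSuff m G E') (hEE' : E ⊆ E') :
    ∃ g' : G ≃g G, IsApprox m G K φ g' E' ∧ ∀ v ∈ E, g' v = g v := by
  classical
  set X := zeroHull m G K with hX
  set F := E.filter (· ∈ X) with hFdef
  set F' := E'.filter (· ∈ X) with hFdef'
  have hmem := hg.mem_zeroHull_iff hK hφ
  have hFF' : F ⊆ F' := Finset.filter_subset_filter _ hEE'
  have hF' : IsBase m G K F' := hg.isBase.of_superset hK hFF'
    (fun v hv => (Finset.mem_filter.1 hv).2) (hK.filter_zeroHull hE')
  obtain ⟨-, h2, h3⟩ := hg.isBase.delta_union_eq hg.selfSuff hF' (Finset.filter_subset _ _) hFF'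
  have hgF : IsBase m G K (F.image g) := hg.image_filter ▸ hφ.isBase_image hK hg.isBase
  obtain ⟨-, h5, h6⟩ := hgF.delta_union_eq (hg.selfSuff.image_aut g) (hφ.isBase_image hK hF')
    (Finset.image_subset_image (Finset.filter_subset _ _))
    (hg.image_filter ▸ Finset.image_subset_image hFF')
  set p : V → V := fun v => if v ∈ E then g v else φ v with hp
  have pE : ∀ v ∈ E, p v = g v := fun v hv => if_pos hv
  have pF : ∀ v ∈ F', p v = φ v := fun v hv => by
    by_cases hvE : v ∈ E
    · rw [pE v hvE, hg.eq_of_mem v hvE (Finset.mem_filter.1 hv).2]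
    · exact if_neg hvE
  have hEX : ∀ v ∈ E, v ∉ F' → v ∉ X := fun v hv hvF hvX =>
    hvF (Finset.mem_filter.2 ⟨hEE' hv, hvX⟩)
  have hFX : ∀ v ∈ F', v ∈ X := fun v hv => (Finset.mem_filter.1 hv).2
  have pX : ∀ v ∈ E ∪ F', (p v ∈ X ↔ v ∈ X) := by
    intro v hv
    rcases Finset.mem_union.1 hv with hv | hv
    · rw [pE v hv]
      exact hmem v
    · rw [pF v hv]
      exact hφ.mem_iff v
  have himage : (E ∪ F').image p = E.image g ∪ F'.image φ := by
    rw [Finset.image_union]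
    congr 1
    · exact Finset.image_congr pE
    · exact Finset.image_congr pF
  -- Freeness on the image side applies because g and φ both preserve X: g u lies outside X, and φ w
  -- could lie in g[E] only if w were in E.
  have mixed : ∀ u ∈ E, u ∉ F' → ∀ w ∈ F', w ∉ E → ¬ G.Adj (p u) (p w) := by
    intro u hu huF w hw hwE
    rw [pE u hu, pF w hw]
    refine h6 _ (Finset.mem_image_of_mem g hu) ?_ _ (Finset.mem_image_of_mem φ hw) ?_
    · rintro hmem'
      obtain ⟨x, hx, hxu⟩ := Finset.mem_image.1 hmem'
      exact hEX u hu huF ((hmem u).1 (hxu ▸ (hφ.mem_iff x).2 (hFX x hx)))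
    · rintro hmem'
      obtain ⟨x, hx, hxw⟩ := Finset.mem_image.1 hmem'
      have hxX : x ∈ X := (hmem x).1 (hxw ▸ (hφ.mem_iff w).2 (hFX w hw))
      rw [hg.eq_of_mem x hx hxX] at hxw
      exact hwE (φ.injective hxw ▸ hx)
  have cases : ∀ u ∈ E ∪ F', ∀ w ∈ E ∪ F', (u ∈ E ∧ w ∈ E) ∨ (u ∈ F' ∧ w ∈ F') ∨
      (u ∈ E ∧ u ∉ F' ∧ w ∈ F' ∧ w ∉ E) ∨ (w ∈ E ∧ w ∉ F' ∧ u ∈ F' ∧ u ∉ E) := by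
    intro u hu w hw
    rw [Finset.mem_union] at hu hw
    tauto
  have pinj : Set.InjOn p (E ∪ F' : Finset V) := by
    intro u hu w hw huw
    have hX' : u ∈ X ↔ w ∈ X := by rw [← pX u hu, ← pX w hw, huw]
    rcases cases u hu w hw with h | h | h | h
    · rw [pE u h.1, pE w h.2] at huw
      exact g.injective huw
    · rw [pF u h.1, pF w h.2] at huw
      exact φ.injective huw
    · exact absurd (hX'.2 (hFX w h.2.2.1)) (hEX u h.1 h.2.1)
    · exact absurd (hX'.1 (hFX u h.2.2.1)) (hEX w h.1 h.2.1)
  have padj : ∀ u ∈ E ∪ F', ∀ w ∈ E ∪ F', (G.Adj (p u) (p w) ↔ G.Adj u w) := by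
    intro u hu w hw
    rcases cases u hu w hw with h | h | h | h
    · rw [pE u h.1, pE w h.2]
      exact g.map_adj_iff
    · rw [pF u h.1, pF w h.2]
      exact hφ.adj_iff u (hFX u h.1) w (hFX w h.2)
    · exact iff_of_false (mixed u h.1 h.2.1 w h.2.2.1 h.2.2.2)
        (h3 u h.1 h.2.1 w h.2.2.1 h.2.2.2)
    · exact iff_of_false (fun e => mixed w h.1 h.2.1 u h.2.2.1 h.2.2.2 e.symm)
        (fun e => h3 w h.1 h.2.1 u h.2.2.1 h.2.2.2 e.symm)
  obtain ⟨g', hg'⟩ := hG.exists_extension h2 (himage ▸ h5) pinj padj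
  refine ⟨g', ⟨hE', hF', fun v hv hvX => ?_⟩, fun v hv => ?_⟩
  · have hvF : v ∈ F' := Finset.mem_filter.2 ⟨hv, hvX⟩
    rw [hg' v (Finset.mem_union_right _ hvF), pF v hvF]
  · rw [hg' v (Finset.mem_union_left _ hv), pE v hv]

end

/-- The approximations of `φ`, ordered by extension. -/
def Approx (m : ℕ) (G : SimpleGraph V) (K : Finset V) (φ : V ≃ V) : Type _ :=
  {p : (G ≃g G) × Finset V // IsApprox m G K φ p.1 p.2}

instance (K : Finset V) (φ : V ≃ V) : Preorder (Approx m G K φ) where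
  le p q := p.1.2 ⊆ q.1.2 ∧ ∀ v ∈ p.1.2, q.1.1 v = p.1.1 v
  le_refl p := ⟨subset_rfl, fun _ _ => rfl⟩
  le_trans p q r hpq hqr := ⟨hpq.1.trans hqr.1, fun v hv =>
    (hqr.2 v (hpq.1 hv)).trans (hpq.2 v hv)⟩

variable {K : Finset V} {φ : V ≃ V}

theorem Approx.exists_mem_domain (hG : IsGeneric m G) (hK : SelfSuff m G K)
    (hφ : RestrictsToAut G (zeroHull m G K) φ) (p : Approx m G K φ) (v : V) :
    ∃ q : Approx m G K φ, v ∈ q.1.2 ∧ p ≤ q := by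
  classical
  have h := subset_cl hG (insert v p.1.2)
  have hp := (Finset.subset_insert v p.1.2).trans h
  obtain ⟨g', h1, h2⟩ := p.2.exists_extension hG hK hφ (selfSuff_cl hG _) hp
  exact ⟨⟨⟨g', _⟩, h1⟩, h (Finset.mem_insert_self _ _), hp, h2⟩

/-- The "back" half is the "forth" half applied to the inverse approximation. -/
theorem Approx.exists_mem_range (hG : IsGeneric m G) (hK : SelfSuff m G K)
    (hφ : RestrictsToAut G (zeroHull m G K) φ) (p : Approx m G K φ) (v : V) :
    ∃ q : Approx m G K φ, (∃ u ∈ q.1.2, q.1.1 u = v) ∧ p ≤ q := by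
  classical
  obtain ⟨⟨⟨g, E⟩, hg⟩, hv, hE, heq⟩ := Approx.exists_mem_domain hG hK hφ.symm
    ⟨⟨_, _⟩, p.2.symm hK hφ⟩ v
  simp only at hv hE heq
  refine ⟨⟨⟨g.symm, E.image g⟩, hg.symm hK hφ.symm⟩,
    ⟨g v, Finset.mem_image_of_mem g hv, g.symm_apply_apply v⟩, ?_, ?_⟩
  · intro u hu
    refine Finset.mem_image.2 ⟨p.1.1 u, hE (Finset.mem_image_of_mem _ hu), ?_⟩
    rw [heq _ (Finset.mem_image_of_mem _ hu)]
    exact p.1.1.symm_apply_apply u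
  · intro u hu
    change g.symm u = p.1.1 u
    rw [g.symm_apply_eq, heq _ (Finset.mem_image_of_mem _ hu)]
    exact (p.1.1.symm_apply_apply u).symm

/-- Back and forth: an approximation of `φ` extends to an automorphism extending the restriction
of `φ`. -/
theorem IsApprox.exists_aut (hG : IsGeneric m G) (hK : SelfSuff m G K)
    (hφ : RestrictsToAut G (zeroHull m G K) φ) {g : G ≃g G} {E : Finset V}
    (hg : IsApprox m G K φ g E) :
    ∃ h : G ≃g G, (∀ v ∈ E, h v = g v) ∧ ∀ v ∈ zeroHull m G K, h v = φ v := by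
  classical
  have := hG.countable
  let := Encodable.ofCountable V
  let p : Approx m G K φ := ⟨⟨g, E⟩, hg⟩
  -- Countably many cofinal demands, two per vertex: being in the domain and being in the range. An
  -- ideal meeting all of them yields the limit map.
  let D : V ⊕ V → Order.Cofinal (Approx m G K φ) := Sum.elim
    (fun v => ⟨{q | v ∈ q.1.2}, fun p => (Approx.exists_mem_domain hG hK hφ p v)⟩)
    (fun v => ⟨{q | ∃ u ∈ q.1.2, q.1.1 u = v}, fun p => (Approx.exists_mem_range hG hK hφ p v)⟩)
  let I := Order.idealOfCofinals p D
  have hdom : ∀ v, ∃ q ∈ I, v ∈ q.1.2 := fun v => by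
    obtain ⟨q, h1, h2⟩ := Order.cofinal_meets_idealOfCofinals p D (Sum.inl v)
    exact ⟨q, h2, h1⟩
  have hran : ∀ v, ∃ q ∈ I, ∃ u ∈ q.1.2, q.1.1 u = v := fun v => by
    obtain ⟨q, h1, h2⟩ := Order.cofinal_meets_idealOfCofinals p D (Sum.inr v)
    exact ⟨q, h2, h1⟩
  choose q hqI hq using hdom
  let h : V → V := fun v => (q v).1.1 v
  have hh : ∀ r ∈ I, ∀ v ∈ r.1.2, h v = r.1.1 v := by
    intro r hr v hv
    obtain ⟨s, -, hs1, hs2⟩ := I.directed _ (hqI v) _ hr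
    exact (hs1.2 v (hq v)).symm.trans (hs2.2 v hv)
  -- Injectivity and adjacency involve two vertices at a time, so they are inherited from a single
  -- automorphism.
  have hpair : ∀ u v, ∃ r : G ≃g G, h u = r u ∧ h v = r v := by
    intro u v
    obtain ⟨s, hs, hs1, hs2⟩ := I.directed _ (hqI u) _ (hqI v)
    exact ⟨s.1.1, hh s hs u (hs1.1 (hq u)), hh s hs v (hs2.1 (hq v))⟩
  have hbij : Function.Bijective h := by
    refine ⟨fun u v huv => ?_, fun v => ?_⟩
    · obtain ⟨r, hu, hv⟩ := hpair u v
      exact r.injective (hu.symm.trans (huv.trans hv))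
    · obtain ⟨r, hr, u, hu, rfl⟩ := hran v
      exact ⟨u, hh r hr u hu⟩
  refine ⟨⟨Equiv.ofBijective h hbij, fun {u v} => ?_⟩, fun v hv => ?_, fun v hv => ?_⟩
  · obtain ⟨r, hu, hv⟩ := hpair u v
    change G.Adj (h u) (h v) ↔ G.Adj u v
    rw [hu, hv]
    exact r.map_adj_iff
  · exact hh p (Order.mem_idealOfCofinals p D) v hv
  · exact (q v).2.eq_of_mem v (hq v) hv

end Extension

/-! ### Surjectivity and local lifting for the restriction map -/

section Restriction

variable {V : Type*} {m : ℕ} {G : SimpleGraph V} {K : Finset V}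

open Classical in
/-- An automorphism of an induced subgraph, extended by the identity. -/
noncomputable def extendById (X : Set V) (f : G.induce X ≃g G.induce X) : V ≃ V :=
  Equiv.Perm.ofSubtype (p := (· ∈ X)) f.toEquiv

theorem extendById_apply {X : Set V} (f : G.induce X ≃g G.induce X) (x : X) :
    extendById X f x = f x := by
  classical
  exact Equiv.Perm.ofSubtype_apply_coe _ x

theorem restrictsToAut_extendById {X : Set V} (f : G.induce X ≃g G.induce X) :
    RestrictsToAut G X (extendById X f) := by
  classical
  refine ⟨fun v => ?_, fun u hu w hw => ?_⟩
  · by_cases hv : v ∈ X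
    · exact iff_of_true (extendById_apply f ⟨v, hv⟩ ▸ (f ⟨v, hv⟩).2) hv
    · rw [extendById, Equiv.Perm.ofSubtype_apply_of_not_mem _ hv]
  · rw [extendById_apply f ⟨u, hu⟩, extendById_apply f ⟨w, hw⟩]
    exact f.map_adj_iff

theorem exists_restrictHom_eq (hG : IsGeneric m G) (hK : SelfSuff m G K)
    {f : G.induce (zeroHull m G K) ≃g G.induce (zeroHull m G K)} {g : G ≃g G} {E : Finset V}
    (hg : IsApprox m G K (extendById _ f) g E) :
    ∃ h : setStab G (zeroHull m G K), restrictHom G _ h = f ∧ ∀ v ∈ E, h.1 v = g v := by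
  have hφ := restrictsToAut_extendById f
  obtain ⟨h, h1, h2⟩ := hg.exists_aut hG hK hφ
  refine ⟨⟨h, ?_⟩, ?_, h1⟩
  · change h '' _ = _
    ext v
    constructor
    · rintro ⟨u, hu, rfl⟩
      rw [h2 u hu]
      exact (hφ.mem_iff u).2 hu
    · intro hv
      have hu := (hφ.symm.mem_iff v).2 hv
      exact ⟨_, hu, by rw [h2 _ hu, Equiv.apply_symm_apply]⟩
  · ext x
    rw [restrictHom_apply_coe]
    exact (h2 x x.2).trans (extendById_apply f x)

theorem restrictHom_surjective (hG : IsGeneric m G) (hK : SelfSuff m G K) :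
    Function.Surjective (restrictHom G (zeroHull m G K)) := by
  classical
  intro f
  have hφ := restrictsToAut_extendById f
  -- The initial approximation lives on K: φ[K] is self-sufficient, so homogeneity extends the
  -- restriction of φ to K.
  obtain ⟨g, hg⟩ := hG.exists_extension hK (hφ.isBase_image hK (isBase_self hK)).selfSuff
    (extendById _ f).injective.injOn
    (fun u hu w hw => hφ.adj_iff u (subset_zeroHull K hu) w (subset_zeroHull K hw))
  have happ : IsApprox m G K (extendById _ f) g K := by
    refine ⟨hK, ?_, fun v hv _ => hg v hv⟩
    rw [Finset.filter_true_of_mem fun v hv => subset_zeroHull K hv]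
    exact isBase_self hK
  obtain ⟨h, rfl, -⟩ := exists_restrictHom_eq hG hK happ
  exact ⟨h, rfl⟩

/-- An automorphism of the hull close to `restrictHom G _ h` lifts to an automorphism
close to `h`. -/
theorem exists_restrictHom_eq_of_close (hG : IsGeneric m G) (hK : SelfSuff m G K)
    (h : setStab G (zeroHull m G K)) (B : Finset V) :
    ∃ C : Finset (zeroHull m G K), ∀ f, (∀ x ∈ C, f x = restrictHom G _ h x) →
      ∃ h' : setStab G (zeroHull m G K), restrictHom G _ h' = f ∧ ∀ v ∈ B, h'.1 v = h.1 v := by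
  classical
  -- Including K makes the trace of E on the hull a base; including B keeps the lift equal to h on
  -- B.
  have hBK := subset_cl hG (B ∪ K)
  have hE := selfSuff_cl hG (B ∪ K)
  set E := cl m G (B ∪ K)
  refine ⟨E.subtype (· ∈ zeroHull m G K), fun f hf => ?_⟩
  have happ : IsApprox m G K (extendById _ f) h.1 E := by
    refine ⟨hE, (isBase_self hK).of_superset hK (fun v hv => Finset.mem_filter.2
      ⟨hBK (Finset.mem_union_right _ hv), subset_zeroHull K hv⟩)
      (fun v hv => (Finset.mem_filter.1 hv).2) (hK.filter_zeroHull hE), fun v hv hvX => ?_⟩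
    rw [extendById_apply f ⟨v, hvX⟩, hf ⟨v, hvX⟩ (Finset.mem_subtype.2 hv),
      restrictHom_apply_coe]
  obtain ⟨h', h1, h2⟩ := exists_restrictHom_eq hG hK happ
  exact ⟨h', h1, fun v hv => h2 v (hBK (Finset.mem_union_left _ hv))⟩

end Restriction

/-! ### The automorphism group as a Polish group -/

section Topology

variable {V : Type*} {G : SimpleGraph V}

theorem isInducing_coe_aut [TopologicalSpace V] [DiscreteTopology V] :
    Topology.IsInducing (fun (g : G ≃g G) (v : V) => g v) := by
  rename_i t _
  have h : t = ⊥ := DiscreteTopology.eq_bot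
  refine ⟨?_⟩
  subst h
  rfl

theorem continuous_aut_iff [TopologicalSpace V] [DiscreteTopology V] {Y : Type*}
    [TopologicalSpace Y] {f : Y → (G ≃g G)} :
    Continuous f ↔ ∀ v, Continuous fun y => f y v := by
  rw [isInducing_coe_aut.continuous_iff, continuous_pi_iff]
  rfl

theorem continuous_apply_aut [TopologicalSpace V] [DiscreteTopology V] (v : V) :
    Continuous fun g : G ≃g G => g v :=
  continuous_aut_iff.1 continuous_id v

theorem isClosed_ofPred_forall {Y ι : Type*} [TopologicalSpace Y] {p : ι → Y → Prop}
    (h : ∀ i, IsClosed {y | p i y}) : IsClosed {y | ∀ i, p i y} := by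
  have : {y | ∀ i, p i y} = ⋂ i, {y | p i y} := by
    ext y
    simp
  exact this ▸ isClosed_iInter h

theorem isOpen_agree (g : G ≃g G) (B : Finset V) :
    IsOpen {h : G ≃g G | ∀ v ∈ B, h v = g v} := by
  let : TopologicalSpace V := ⊥
  have : DiscreteTopology V := ⟨rfl⟩
  have h : {h : G ≃g G | ∀ v ∈ B, h v = g v} = ⋂ v ∈ B, (fun h : G ≃g G => h v) ⁻¹' {g v} := by
    ext h
    simp
  rw [h]
  exact isOpen_biInter_finset fun v _ => (isOpen_discrete {g v}).preimage (continuous_apply_aut v)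

theorem exists_agree_subset {U : Set (G ≃g G)} (hU : IsOpen U) {g : G ≃g G} (hg : g ∈ U) :
    ∃ B : Finset V, {h : G ≃g G | ∀ v ∈ B, h v = g v} ⊆ U := by
  let : TopologicalSpace V := ⊥
  have : DiscreteTopology V := ⟨rfl⟩
  obtain ⟨W, hW, rfl⟩ := isInducing_coe_aut.isOpen_iff.1 hU
  obtain ⟨B, u, hu, hsub⟩ := isOpen_pi_iff.1 hW _ hg
  refine ⟨B, fun h hh => hsub fun v hv => ?_⟩
  change h v ∈ u v
  rw [hh v hv]
  exact (hu v hv).2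

instance : IsTopologicalGroup (G ≃g G) where
  continuous_mul := by
    let : TopologicalSpace V := ⊥
    have : DiscreteTopology V := ⟨rfl⟩
    refine continuous_aut_iff.2 fun v => continuous_discrete_rng.2 fun w => ?_
    refine isOpen_iff_forall_mem_open.2 fun p hp => ?_
    refine ⟨{h | ∀ x ∈ ({p.2 v} : Finset V), h x = p.1 x} ×ˢ
      {h | ∀ x ∈ ({v} : Finset V), h x = p.2 x}, ?_,
      (isOpen_agree _ _).prod (isOpen_agree _ _), ⟨fun _ _ => rfl, fun _ _ => rfl⟩⟩
    rintro q ⟨h1, h2⟩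
    change q.1 (q.2 v) = w
    rw [h2 v (Finset.mem_singleton_self v), h1 _ (Finset.mem_singleton_self _)]
    exact hp
  continuous_inv := by
    let : TopologicalSpace V := ⊥
    have : DiscreteTopology V := ⟨rfl⟩
    refine continuous_aut_iff.2 fun v => continuous_discrete_rng.2 fun w => ?_
    refine isOpen_iff_forall_mem_open.2 fun p hp => ?_
    refine ⟨{h | ∀ x ∈ ({w} : Finset V), h x = p x}, ?_, isOpen_agree _ _, fun _ _ => rfl⟩
    intro q hq
    have hp : p.symm v = w := hp
    change q.symm v = w
    rw [q.symm_apply_eq, hq w (Finset.mem_singleton_self w), ← hp, p.apply_symm_apply]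

theorem polishSpace_of_countable_discrete [TopologicalSpace V] [DiscreteTopology V]
    [Countable V] : PolishSpace V := by
  obtain ⟨f, hf⟩ := exists_injective_nat V
  exact (Topology.IsClosedEmbedding.of_continuous_injective_isClosedMap
    continuous_of_discreteTopology hf fun s _ => isClosed_discrete (f '' s)).polishSpace

/-- Recording g together with its inverse gives a closed image; a pointwise limit of bijections
alone may fail to be surjective. -/
theorem polishSpace_aut [Countable V] : PolishSpace (G ≃g G) := by
  let : TopologicalSpace V := ⊥
  have : DiscreteTopology V := ⟨rfl⟩
  have : PolishSpace V := polishSpace_of_countable_discrete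
  let e : (G ≃g G) → (V → V) × (V → V) := fun g => (fun v => g v, fun v => g⁻¹ v)
  have happ : ∀ v, Continuous fun g : G ≃g G => g⁻¹ v := fun v =>
    (continuous_apply_aut v).comp continuous_inv
  have hcont : Continuous e :=
    (continuous_pi continuous_apply_aut).prodMk (continuous_pi happ)
  have hind : Topology.IsInducing e :=
    Topology.IsInducing.of_comp hcont continuous_fst isInducing_coe_aut
  have hinj : Function.Injective e := fun g h hgh =>
    RelIso.ext fun v => congrFun (congrArg Prod.fst hgh) v
  refine (Topology.IsClosedEmbedding.mk ⟨hind, hinj⟩ ?_).polishSpace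
  have hrange : Set.range e = {p | (∀ v, p.2 (p.1 v) = v) ∧ (∀ v, p.1 (p.2 v) = v) ∧
      ∀ u v, (G.Adj (p.1 u) (p.1 v) ↔ G.Adj u v)} := by
    ext p
    constructor
    · rintro ⟨g, rfl⟩
      exact ⟨g.symm_apply_apply, g.apply_symm_apply, fun u v => g.map_adj_iff⟩
    · rintro ⟨h1, h2, h3⟩
      exact ⟨⟨⟨p.1, p.2, h1, h2⟩, fun {u v} => h3 u v⟩, rfl⟩
  have heval : ∀ v, Continuous fun p : (V → V) × (V → V) => p.1 v := fun v =>
    (continuous_apply v).comp continuous_fst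
  have heval' : ∀ v, Continuous fun p : (V → V) × (V → V) => p.2 v := fun v =>
    (continuous_apply v).comp continuous_snd
  have hcomp : Continuous fun q : (V → V) × V => q.1 q.2 := by
    refine continuous_prod_of_discrete_right.2 fun v => continuous_apply v
  rw [hrange]
  refine IsClosed.inter ?_ (IsClosed.inter ?_ ?_)
  · exact isClosed_ofPred_forall fun v => isClosed_eq
      (hcomp.comp (continuous_snd.prodMk (heval v))) continuous_const
  · exact isClosed_ofPred_forall fun v => isClosed_eq
      (hcomp.comp (continuous_fst.prodMk (heval' v))) continuous_const
  · refine isClosed_ofPred_forall fun u => isClosed_ofPred_forall fun v => ?_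
    exact (isClosed_discrete {q : V × V | G.Adj q.1 q.2 ↔ G.Adj u v}).preimage
      ((heval u).prodMk (heval v))

theorem continuous_restrictHom (X : Set V) : Continuous (restrictHom G X) := by
  let : TopologicalSpace V := ⊥
  have : DiscreteTopology V := ⟨rfl⟩
  refine continuous_aut_iff.2 fun x => ?_
  exact ((continuous_apply_aut x.1).comp continuous_subtype_val).subtype_mk _

theorem isOpenMap_restrictHom {X : Set V}
    (hX : ∀ (h : setStab G X) (B : Finset V), ∃ C : Finset X, ∀ f,
      (∀ x ∈ C, f x = restrictHom G X h x) →
        ∃ h' : setStab G X, restrictHom G X h' = f ∧ ∀ v ∈ B, h'.1 v = h.1 v) :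
    IsOpenMap (restrictHom G X) := by
  rintro _ ⟨U, hU, rfl⟩
  refine isOpen_iff_forall_mem_open.2 ?_
  rintro _ ⟨h, hh, rfl⟩
  obtain ⟨B, hB⟩ := exists_agree_subset hU hh
  obtain ⟨C, hC⟩ := hX h B
  refine ⟨_, fun f hf => ?_, isOpen_agree (restrictHom G X h) C, fun _ _ => rfl⟩
  obtain ⟨h', rfl, h2⟩ := hC f hf
  exact ⟨h', hB h2, rfl⟩

end Topology

/-! ### Small index and open subgroups -/

section SmallIndex

theorem SmallIndex.subgroupOf {Γ : Type*} [Group Γ] {H : Subgroup Γ} (hH : SmallIndex H)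
    (S : Subgroup Γ) : SmallIndex (H.subgroupOf S) := by
  refine (Cardinal.mk_le_of_injective (f := Quotient.map' (s₁ := QuotientGroup.leftRel _)
    (s₂ := QuotientGroup.leftRel H) S.subtype ?_) ?_).trans_lt hH
  · intro a b
    simp only [QuotientGroup.leftRel_apply]
    exact id
  · refine Quotient.ind₂' fun a b h => ?_
    rw [Quotient.map'_mk'', Quotient.map'_mk'', Quotient.eq'', QuotientGroup.leftRel_apply] at h
    rw [Quotient.eq'', QuotientGroup.leftRel_apply]
    exact h

/-- H ∩ S has small index in S, hence is open in S and so in Γ; H contains this open subgroup. -/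
theorem HasSIP.of_isOpen_subgroup {Γ : Type*} [Group Γ] [TopologicalSpace Γ]
    [IsTopologicalGroup Γ] {S : Subgroup Γ} (hS : IsOpen (S : Set Γ)) (h : HasSIP S) :
    HasSIP Γ := by
  intro H hH
  have h1 := hS.isOpenMap_subtype_val _ (h _ (hH.subgroupOf S))
  refine Subgroup.isOpen_mono (H₁ := (H.subgroupOf S).map S.subtype) ?_ h1
  rintro _ ⟨x, hx, rfl⟩
  exact hx

/-- Over a countable vertex set, a subgroup containing the pointwise stabiliser of a finite set
has countable index. -/
theorem smallIndex_of_forall_agree {V : Type*} [Countable V] {G : SimpleGraph V}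
    {S : Subgroup (G ≃g G)} (B : Finset V) (hB : ∀ g : G ≃g G, (∀ v ∈ B, g v = v) → g ∈ S) :
    SmallIndex S := by
  -- A coset is determined by its representative's values on the finite set B, and there are only
  -- countably many such tuples.
  have hinj : Function.Injective fun (q : (G ≃g G) ⧸ S) (v : B) => q.out v.1 := by
    intro q r hqr
    rw [← q.out_eq', ← r.out_eq', QuotientGroup.eq]
    refine hB _ fun v hv => ?_
    have h : q.out v = r.out v := congrFun hqr ⟨v, hv⟩
    rw [RelIso.mul_apply, ← h, RelIso.inv_apply_self]
  have : Countable ((G ≃g G) ⧸ S) := hinj.countable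
  exact (Cardinal.mk_le_aleph0_iff.2 this).trans_lt Cardinal.aleph0_lt_continuum

theorem isOpen_of_forall_agree {V : Type*} {G : SimpleGraph V}
    {S : Subgroup (G ≃g G)} (B : Finset V) (hB : ∀ g : G ≃g G, (∀ v ∈ B, g v = v) → g ∈ S) :
    IsOpen (S : Set (G ≃g G)) :=
  S.isOpen_of_mem_nhds (g := 1) (Filter.mem_of_superset
    ((isOpen_agree 1 B).mem_nhds fun _ _ => rfl) hB)

end SmallIndex

/-- An automorphism carries the hull of K to the hull of its image, which here is K itself. -/
theorem mem_setStab_of_forall_mem_eq {V : Type*} {m : ℕ} {G : SimpleGraph V} {K : Finset V}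
    (g : G ≃g G) (hg : ∀ v ∈ K, g v = v) : g ∈ setStab G (zeroHull m G K) := by
  classical
  have hK : K.image g = K :=
    (Finset.image_congr (g := id) hg).trans Finset.image_id
  have hmem : ∀ v, g v ∈ zeroHull m G K ↔ v ∈ zeroHull m G K := fun v => by
    conv_rhs => rw [← mem_zeroHull_image_aut_iff g, hK]
  change g '' _ = _
  ext v
  constructor
  · rintro ⟨u, hu, rfl⟩
    exact (hmem u).2 hu
  · intro hv
    refine ⟨g.symm v, (hmem _).1 ?_, g.apply_symm_apply v⟩
    rwa [g.apply_symm_apply]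

end AbInitio

theorem mainTheorem5 {V : Type*} (m : ℕ) (hm : 2 ≤ m) (M : SimpleGraph V)
    (hM : AbInitio.IsGeneric m M) (A : Finset V) (X : Set V)
    (hX : X = AbInitio.gcl m M (A : Set V)) :
    (IsClopen (AbInitio.setStab M X : Set (M ≃g M)) ∧
      IsTopologicalGroup (AbInitio.setStab M X) ∧ PolishSpace (AbInitio.setStab M X)) ∧
    AbInitio.SmallIndex (AbInitio.setStab M X) ∧
    (AbInitio.HasSIP (AbInitio.setStab M X) → AbInitio.HasSIP (M ≃g M)) ∧
    (Continuous (AbInitio.restrictHom M X) ∧ Function.Surjective (AbInitio.restrictHom M X) ∧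
      IsOpenMap (AbInitio.restrictHom M X)) := by
  have := hM.countable
  have hK := AbInitio.selfSuff_cl hM A
  rw [AbInitio.gcl_eq_zeroHull hM] at hX
  subst hX
  have hopen := AbInitio.isOpen_of_forall_agree (G := M) (AbInitio.cl m M A) fun g hg =>
    AbInitio.mem_setStab_of_forall_mem_eq (m := m) g hg
  have hclosed := Subgroup.isClosed_of_isOpen _ hopen
  have := AbInitio.polishSpace_aut (G := M)
  exact ⟨⟨⟨hclosed, hopen⟩, inferInstance, hclosed.polishSpace⟩,
    AbInitio.smallIndex_of_forall_agree (AbInitio.cl m M A) fun g hg =>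
      AbInitio.mem_setStab_of_forall_mem_eq g hg,
    fun h => h.of_isOpen_subgroup hopen,
    AbInitio.continuous_restrictHom _, AbInitio.restrictHom_surjective hM hK,
    AbInitio.isOpenMap_restrictHom (AbInitio.exists_restrictHom_eq_of_close hM hK)⟩
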